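/- Let $p,q\in\mathbb N$ with $\gcd(p,q)=1$ and $q\ge 3$, let $\lambda=e^{2\pi i p/q}$, and let $F_\lambda:\mathbb C\to\mathbb C$, $F_\lambda(z)=\lambda\,(z-H(z))$, where $H(z)=1$ if $\operatorname{Im} z\ge 0$ and $H(z)=-1$ if $\operatorname{Im} z<0$. Let $\mathcal F=\{z\in\mathbb C:\operatorname{Im}(F_\lambda^i(z))=0\text{ for some } i\ge 0\}$ be the critical set and $\mathcal U=\mathbb C\setminus\overline{\mathcal F}$ the regular set. For $z\in\mathcal U$ the itinerary $\underline I(z)$ is the sequence of symbols whose $i$-th term ($i\ge0$) is $+$ if $\operatorname{Im}(F_\lambda^i(z))>0$ and $-$ if $\operatorname{Im}(F_\lambda^i(z))<0$; it is called periodic if $S^n(\underline I(z))=\underline I(z)$ for some $n\ge 1$, where $S$ is the shift, and the least such $n$ is its period. Let $z\in\mathcal U$ and let $B=\{w\in\mathcal U:\underline I(w)=\underline I(z)\}$. Then: 1. $\underline I(z)$ is periodic if and only if $z$ is a periodic point of $F_\lambda$. 2. $B$ is bounded and convex. 3. If $\underline I(z)$ is periodic with period $\ell$, then $F_\lambda^\ell$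 maps $B$ bijectively onto $B$, and it is the first return map to $B$, that is, $F_\lambda^n(w)\notin B$ for all $w\in B$ and $0<n<\ell$. If $q\nmid\ell$, then $\lambda^\ell\ne 1$ and $F_\lambda^\ell$ restricted to $B$ is the rotation $w\mapsto c+\lambda^\ell (w-c)$ about some point $c\in B$. If $q\mid\ell$, then $F_\lambda^\ell(w)=w$ for all $w\in B$. -/

import Mathlib

namespace PiecewiseRotation

/-- The function `H`: it is `1` on the closed upper half plane and `-1` on the open lower one. -/
noncomputable def H (z : ℂ) : ℂ := if 0 ≤ z.im then 1 else -1

/-- The piecewise rotation `F_lam (z) = lam * (z - H z)`. -/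
noncomputable def F (lam z : ℂ) : ℂ := lam * (z - H z)

/-- The critical set: all the points whose forward orbit meets the real line. -/
def criticalSet (lam : ℂ) : Set ℂ := {z | ∃ i : ℕ, ((F lam)^[i] z).im = 0}

/-- The regular set: the complement of the closure of the critical set. -/
def regularSet (lam : ℂ) : Set ℂ := (closure (criticalSet lam))ᶜ

/-- The address: `+` (the value `1`) on the open upper half plane, `-` (the value `-1`) on the open
lower half plane. On the real line, where there is no address, the value is `0`; orbits of regular
points never get there, see `itinerary_eq_one_or_neg_one`. -/
noncomputable def address (z : ℂ) : SignType := SignType.sign z.im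

/-- The itinerary of `z`: the sequence of the addresses along the forward orbit. -/
noncomputable def itinerary (lam z : ℂ) : ℕ → SignType := fun i => address ((F lam)^[i] z)

/-- The shift on infinite sequences of symbols. -/
def shift (J : ℕ → SignType) : ℕ → SignType := fun i => J (i + 1)

/-- `sameItinerary lam J` is the set `B(J)` of regular points whose itinerary is `J`. -/
def sameItinerary (lam : ℂ) (J : ℕ → SignType) : Set ℂ :=
  {w | w ∈ regularSet lam ∧ itinerary lam w = J}

/-- The number `exp (2 π i p / q)`. -/
noncomputable def rootOfUnity (p q : ℕ) : ℂ :=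
  Complex.exp ((p : ℂ) / (q : ℂ) * (2 * (Real.pi : ℂ) * Complex.I))

theorem itinerary_eq_one_or_neg_one {lam z : ℂ} (hz : z ∈ regularSet lam) (i : ℕ) :
    itinerary lam z i = 1 ∨ itinerary lam z i = -1 := by
  have h : ((F lam)^[i] z).im ≠ 0 := fun h => hz (subset_closure ⟨i, h⟩)
  rcases lt_or_gt_of_ne h with h | h
  · exact Or.inr (sign_neg h)
  · exact Or.inl (sign_pos h)

end PiecewiseRotation

namespace PiecewiseRotation

open ComplexConjugate

/-! ### Affine behaviour along a common itinerary. -/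

section Dynamics

variable {lam : ℂ}

/-! Among points with a common itinerary every `F^n` is affine with linear part `lam ^ n`. Hence the
points of a given itinerary form a convex set, whose interior is `B` (`sameItinerary_eq_interior`),
and `F^l` maps `B` to itself if the shift by `l` fixes the itinerary.

Boundedness is the main point (`isBounded_sameItinerary`). An unbounded `B` has a limiting direction
`v`, and the half planes visited by the orbit recede along `lam ^ n * v`. This makes the signs
eventually `q`-periodic (`false_of_receding`), which is impossible by a drift argument
(`false_of_periodic_signs`).

Once `B` is bounded, `(F^l)^q` acts on it as a translation, because `lam ^ q = 1`, and a bounded set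
admits only the trivial one. Periodicity and bijectivity follow. The centre of mass of an orbit is
the centre of the rotation. -/

theorem H_congr {x y : ℂ} (h : address x = address y) : H x = H y := by
  have : 0 ≤ x.im ↔ 0 ≤ y.im := by
    rw [← sign_nonneg_iff, ← sign_nonneg_iff (a := y.im)]
    exact iff_of_eq (congrArg (fun s => 0 ≤ s) h)
  simp only [H, this]

theorem address_convexComb {x y : ℂ} (h : address x = address y) {a b : ℝ} (ha : 0 ≤ a)
    (hb : 0 ≤ b) (hab : a + b = 1) : address (a • x + b • y) = address x := by
  have him : (a • x + b • y).im = a * x.im + b * y.im := by simp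
  unfold address at h ⊢
  rw [him]
  rcases lt_trichotomy x.im 0 with hx | hx | hx
  · rw [sign_neg hx] at h ⊢
    have hy : y.im < 0 := sign_eq_neg_one_iff.1 h.symm
    exact sign_neg (convex_Iio (0 : ℝ) hx hy ha hb hab)
  · rw [hx, sign_zero] at h ⊢
    have hy : y.im = 0 := sign_eq_zero_iff.1 h.symm
    simp [hy]
  · rw [sign_pos hx] at h ⊢
    have hy : 0 < y.im := sign_eq_one_iff.1 h.symm
    exact sign_pos (convex_Ioi (0 : ℝ) hx hy ha hb hab)

theorem F_iterate_convexComb {x y : ℂ} {n : ℕ}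
    (h : ∀ i < n, itinerary lam x i = itinerary lam y i) {a b : ℝ} (ha : 0 ≤ a)
    (hb : 0 ≤ b) (hab : a + b = 1) :
    (F lam)^[n] (a • x + b • y) = a • (F lam)^[n] x + b • (F lam)^[n] y := by
  induction n with
  | zero => simp
  | succ n ih =>
    rw [Function.iterate_succ_apply', Function.iterate_succ_apply', Function.iterate_succ_apply',
      ih fun i hi => h i (by omega)]
    have hn : address ((F lam)^[n] x) = address ((F lam)^[n] y) := h n (by omega)
    have hab' : (a : ℂ) + b = 1 := by exact_mod_cast hab
    simp only [F, H_congr (address_convexComb hn ha hb hab)]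
    simp only [H_congr hn, Complex.real_smul]
    linear_combination (lam * H ((F lam)^[n] y)) * hab'

theorem F_iterate_sub {x y : ℂ} {n : ℕ}
    (h : ∀ i < n, itinerary lam x i = itinerary lam y i) :
    (F lam)^[n] x - (F lam)^[n] y = lam ^ n * (x - y) := by
  induction n with
  | zero => simp
  | succ n ih =>
    rw [Function.iterate_succ_apply', Function.iterate_succ_apply', pow_succ', mul_assoc,
      ← ih fun i hi => h i (by omega)]
    have hn : address ((F lam)^[n] x) = address ((F lam)^[n] y) := h n (by omega)
    simp only [F, H_congr hn]
    ring

theorem semiconj_itinerary : Function.Semiconj (itinerary lam) (F lam) shift := by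
  intro z
  funext i
  simp only [itinerary, shift, Function.iterate_succ_apply]

theorem itinerary_F_iterate (n : ℕ) (z : ℂ) :
    itinerary lam ((F lam)^[n] z) = shift^[n] (itinerary lam z) :=
  semiconj_itinerary.iterate_right n z

theorem convex_setOf_itinerary (J : ℕ → SignType) : Convex ℝ {w | itinerary lam w = J} := by
  intro x hx y hy a b ha hb hab
  have hxy : ∀ i, itinerary lam x i = itinerary lam y i := fun i => by
    rw [show itinerary lam x = J from hx, show itinerary lam y = J from hy]
  funext i
  rw [← show itinerary lam x = J from hx]
  simp only [itinerary]
  rw [F_iterate_convexComb (fun i _ => hxy i) ha hb hab]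
  exact address_convexComb (hxy i) ha hb hab

theorem exists_convexComb_eq_zero {r s : ℝ} (hr : r ≠ 0) (hs : s ≠ 0)
    (h : SignType.sign r ≠ SignType.sign s) :
    ∃ a b : ℝ, 0 ≤ a ∧ 0 ≤ b ∧ a + b = 1 ∧ a * r + b * s = 0 := by
  rcases lt_or_gt_of_ne hr with hr | hr <;> rcases lt_or_gt_of_ne hs with hs | hs
  · simp [sign_neg hr, sign_neg hs] at h
  · have : 0 < s - r := by linarith
    refine ⟨s / (s - r), -r / (s - r), by positivity, div_nonneg (by linarith) this.le, ?_, ?_⟩ <;>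
    · field_simp
      ring
  · have : 0 < r - s := by linarith
    refine ⟨-s / (r - s), r / (r - s), div_nonneg (by linarith) this.le, by positivity, ?_, ?_⟩ <;>
    · field_simp
      ring
  · simp [sign_pos hr, sign_pos hs] at h

/-- At a first disagreement, at time `n`, the iterate `F^n` is still affine on the segment from `x`
to `y` and sends its ends to opposite sides of the real line. Some point of the segment is then
critical. -/
theorem itinerary_eq_of_convex_subset {s : Set ℂ} (hs : Convex ℝ s) (hU : s ⊆ regularSet lam)
    {x y : ℂ} (hx : x ∈ s) (hy : y ∈ s) : itinerary lam x = itinerary lam y := by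
  have hne : ∀ w ∈ s, ∀ i, ((F lam)^[i] w).im ≠ 0 :=
    fun w hw i h => hU hw (subset_closure ⟨i, h⟩)
  funext n
  induction n using Nat.strong_induction_on with
  | _ n ih =>
    by_contra h
    obtain ⟨a, b, ha, hb, hab, h0⟩ := exists_convexComb_eq_zero (hne x hx n) (hne y hy n) h
    refine hne _ (hs hx hy ha hb hab) n ?_
    rw [F_iterate_convexComb ih ha hb hab]
    simpa using h0

theorem isOpen_regularSet : IsOpen (regularSet lam) := isClosed_closure.isOpen_compl

theorem sameItinerary_eq_interior {J : ℕ → SignType} (hJ : ∀ i, J i ≠ 0) :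
    sameItinerary lam J = interior {w | itinerary lam w = J} := by
  ext w
  constructor
  · rintro ⟨hw, hwJ⟩
    obtain ⟨ε, hε, hball⟩ := Metric.isOpen_iff.1 isOpen_regularSet w hw
    rw [mem_interior]
    refine ⟨Metric.ball w ε, fun x hx => ?_, Metric.isOpen_ball, Metric.mem_ball_self hε⟩
    exact (itinerary_eq_of_convex_subset (convex_ball w ε) hball hx
      (Metric.mem_ball_self hε)).trans hwJ
  · intro hw
    have hwJ : w ∈ {w | itinerary lam w = J} := interior_subset hw
    refine ⟨fun hcl => ?_, hwJ⟩
    obtain ⟨x, hx, i, hi⟩ := mem_closure_iff.1 hcl _ isOpen_interior hw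
    have hxJ : x ∈ {w | itinerary lam w = J} := interior_subset hx
    apply hJ i
    rw [← show itinerary lam x = J from hxJ]
    simp [itinerary, address, hi]

theorem F_iterate_mem_sameItinerary (hlam : ‖lam‖ = 1) {J : ℕ → SignType} (hJ : ∀ i, J i ≠ 0)
    {l : ℕ} (hl : shift^[l] J = J) {w : ℂ} (hw : w ∈ sameItinerary lam J) :
    (F lam)^[l] w ∈ sameItinerary lam J := by
  rw [sameItinerary_eq_interior hJ] at hw ⊢
  obtain ⟨ε, hε, hball⟩ := Metric.isOpen_iff.1 isOpen_interior w hw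
  rw [mem_interior]
  refine ⟨Metric.ball ((F lam)^[l] w) ε, fun y hy => ?_, Metric.isOpen_ball,
    Metric.mem_ball_self hε⟩
  have hlam0 : lam ≠ 0 := by
    rintro rfl
    simp at hlam
  -- The preimage of `y` under the isometry that agrees with `F^l` near `w`. Balls thus go onto
  -- balls, which keeps the image point in the interior.
  set x := w + (y - (F lam)^[l] w) / lam ^ l with hx
  have hxJ : itinerary lam x = J := by
    apply interior_subset (hball _)
    rw [mem_ball_iff_norm] at hy ⊢
    simpa [hx, hlam] using hy
  have hwJ : w ∈ {w | itinerary lam w = J} := interior_subset hw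
  change itinerary lam w = J at hwJ
  have hsub := F_iterate_sub (lam := lam) (x := x) (y := w) (n := l) fun i _ => by rw [hxJ, hwJ]
  have hxy : (F lam)^[l] x = y := by
    have : lam ^ l * (x - w) = y - (F lam)^[l] w := by
      rw [hx]
      field_simp
      ring
    rw [this] at hsub
    exact sub_left_injective hsub
  change itinerary lam y = J
  rw [← hxy, itinerary_F_iterate, hxJ, hl]

end Dynamics

/-! ### Boundedness of the sets of constant itinerary. -/

section Bounded

variable {lam : ℂ}

theorem norm_mul_conj_eq_one (hlam : ‖lam‖ = 1) : lam * conj lam = 1 := by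
  rw [Complex.mul_conj, Complex.normSq_eq_norm_sq, hlam]
  simp

/-- A bounded-below arithmetic progression has non-negative difference. -/
theorem nonneg_of_forall_pos_add_mul {a b : ℝ} (h : ∀ k : ℕ, 0 < a + k * b) : 0 ≤ b := by
  by_contra! hb
  obtain ⟨k, hk⟩ := exists_nat_gt (a / -b)
  rw [div_lt_iff₀ (by linarith)] at hk
  linarith [h k]

theorem eq_zero_of_im_mul_eq_zero (him : lam.im ≠ 0) {x : ℂ} (h0 : x.im = 0)
    (h1 : (lam * x).im = 0) : x = 0 := by
  rw [Complex.mul_im, h0, mul_zero, zero_add] at h1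
  exact Complex.ext ((mul_eq_zero.1 h1).resolve_left him) h0

/-- Multiplying by the conjugate of the co-rotating vector `lam ^ n * v` cancels the rotation and
leaves a sum. -/
theorem conj_mul_step (hlam : ‖lam‖ = 1) {v : ℂ} {s : ℕ → ℝ} {z : ℕ → ℂ}
    (hz : ∀ n, z (n + 1) = lam * (z n - s n)) (n : ℕ) :
    z (n + 1) * conj (lam ^ (n + 1) * v)
      = z n * conj (lam ^ n * v) - s n * conj (lam ^ n * v) := by
  rw [hz, pow_succ]
  simp only [map_mul, map_pow]
  linear_combination ((z n - s n) * conj lam ^ n * conj v) * norm_mul_conj_eq_one hlam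

theorem conj_mul_iterate (hlam : ‖lam‖ = 1) {v : ℂ} {s : ℕ → ℝ} {z : ℕ → ℂ}
    (hz : ∀ n, z (n + 1) = lam * (z n - s n)) (n k : ℕ) :
    z (n + k) * conj (lam ^ (n + k) * v)
      = z n * conj (lam ^ n * v)
        - ∑ i ∈ Finset.range k, (s (n + i) : ℂ) * conj (lam ^ (n + i) * v) := by
  induction k with
  | zero => simp
  | succ k ih =>
    rw [← add_assoc, conj_mul_step hlam hz, ih, Finset.sum_range_succ]
    ring

theorem sum_range_add_of_periodic {M : Type*} [AddCommGroup M] {q : ℕ} {f : ℕ → M}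
    (hf : ∀ n, f (n + q) = f n) (n : ℕ) :
    ∑ i ∈ Finset.range q, f (n + i) = ∑ i ∈ Finset.range q, f i := by
  induction n with
  | zero => simp
  | succ n ih =>
    rw [← ih]
    have h1 := Finset.sum_range_succ (fun i => f (n + i)) q
    have h2 := Finset.sum_range_succ' (fun i => f (n + i)) q
    rw [h1, hf] at h2
    rw [add_zero] at h2
    rw [add_right_cancel h2]
    exact Finset.sum_congr rfl fun i _ => congrArg f (by omega)

/-- No orbit of the skew rotation `z ↦ lam * (z - s)` whose signs are `q`-periodic stays in the
half planes prescribed by the signs, if these half planes recede in the directions `lam ^ n * v`. -/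
theorem false_of_periodic_signs {q : ℕ} (hq : 0 < q) (hlamq : lam ^ q = 1) (him : lam.im ≠ 0)
    {v : ℂ} (hv : v ≠ 0) {s : ℕ → ℝ} {z : ℕ → ℂ} (hs : ∀ n, s n ≠ 0)
    (hper : ∀ n, s (n + q) = s n)
    (hz : ∀ n, z (n + 1) = lam * (z n - s n)) (hpos : ∀ n, 0 < s n * (z n).im)
    (hrec : ∀ n, 0 ≤ s n * (lam ^ n * v).im) : False := by
  have hlam : ‖lam‖ = 1 := Complex.norm_eq_one_of_pow_eq_one hlamq hq.ne'
  have hlam0 : lam ≠ 0 := by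
    rintro rfl
    simp at him
  set u : ℕ → ℂ := fun n => lam ^ n * v with hu
  have hu0 : ∀ n, u n ≠ 0 := fun n => mul_ne_zero (pow_ne_zero _ hlam0) hv
  have husucc : ∀ n, u (n + 1) = lam * u n := fun n => by simp only [hu]; ring
  have hunorm : ∀ n, conj (u n) * u n = (‖v‖ ^ 2 : ℝ) := fun n => by
    rw [mul_comm, Complex.mul_conj, Complex.normSq_eq_norm_sq]
    simp [hu, hlam]
  have huper : ∀ n, u (n + q) = u n := fun n => by simp only [hu, pow_add, hlamq, mul_one]
  set f : ℕ → ℂ := fun n => (s n : ℂ) * conj (u n) with hf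
  have hfper : ∀ n, f (n + q) = f n := fun n => by simp only [hf, hper, huper]
  set T : ℂ := ∑ i ∈ Finset.range q, f i with hT
  have hcycle : ∀ n k : ℕ, z (n + k * q) * conj (u (n + k * q)) = z n * conj (u n) - k * T := by
    intro n k
    induction k with
    | zero => simp
    | succ k ih =>
      have h := conj_mul_iterate hlam hz (v := v) (n + k * q) q
      rw [show n + (k + 1) * q = n + k * q + q by ring]
      refine h.trans ?_
      rw [show z (n + k * q) * conj (lam ^ (n + k * q) * v) = _ from ih]
      have := sum_range_add_of_periodic hfper (n + k * q)
      simp only [hf, hu] at this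
      rw [this, hT]
      push_cast
      ring
  have hukper : ∀ n k : ℕ, u (n + k * q) = u n ∧ s (n + k * q) = s n := by
    intro n k
    induction k with
    | zero => simp
    | succ k ih =>
      rw [show n + (k + 1) * q = n + k * q + q by ring, huper, hper]
      exact ih
  -- Each cycle moves `z` by a fixed multiple of `-T * u n`. A drift out of the half plane would
  -- eventually leave it.
  have hTle : ∀ n, s n * (T * u n).im ≤ 0 := by
    intro n
    suffices 0 ≤ -(s n * (T * u n).im) by linarith
    refine nonneg_of_forall_pos_add_mul (a := ‖v‖ ^ 2 * (s n * (z n).im)) fun k => ?_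
    have h1 := congrArg (fun x => s n * (x * u n).im) (hcycle n k)
    have h2 := hpos (n + k * q)
    have h3 : 0 < ‖v‖ ^ 2 := by positivity
    simp only [(hukper n k).1, (hukper n k).2, mul_assoc, hunorm, sub_mul] at h1 h2
    rw [Complex.sub_im, Complex.im_mul_ofReal, Complex.im_mul_ofReal,
      show ((k : ℂ) * (T * u n)) = ((k : ℝ) : ℂ) * (T * u n) by simp, Complex.im_ofReal_mul] at h1
    have h4 := mul_pos h3 h2
    linarith
  -- The sum is the imaginary part of `T * conj T`, so all its terms, being of one sign, vanish.
  have hsum : ∑ i ∈ Finset.range q, s i * (T * u i).im = 0 := by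
    have h1 : (T * conj T).im = 0 := by rw [Complex.mul_conj]; simp
    rw [← h1]
    conv_rhs => rw [hT, map_sum, Finset.mul_sum, Complex.im_sum]
    refine Finset.sum_congr rfl fun i _ => ?_
    rw [← Complex.im_ofReal_mul]
    simp only [hf, map_mul, Complex.conj_conj, Complex.conj_ofReal]
    congr 1
    ring
  have hqone : 1 < q := by
    by_contra h
    obtain rfl : q = 1 := by omega
    rw [pow_one] at hlamq
    simp [hlamq] at him
  have hzero : ∀ i < q, (T * u i).im = 0 := fun i hi =>
    (mul_eq_zero.1 ((Finset.sum_eq_zero_iff_of_nonpos fun i _ => hTle i).1 hsum i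
      (Finset.mem_range.2 hi))).resolve_left (hs i)
  have hT0 : T = 0 := by
    have := eq_zero_of_im_mul_eq_zero him (hzero 0 hq) (by
      have := hzero 1 hqone
      rwa [husucc, mul_left_comm] at this)
    exact (mul_eq_zero.1 this).resolve_right (hu0 0)
  have hTim : ∑ i ∈ Finset.range q, s i * (u i).im = 0 := by
    have h := congrArg Complex.im hT0
    rw [hT, Complex.im_sum] at h
    simpa [hf] using h
  have hureal : ∀ i < q, (u i).im = 0 := fun i hi =>
    (mul_eq_zero.1 ((Finset.sum_eq_zero_iff_of_nonneg fun i _ => hrec i).1 hTim i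
      (Finset.mem_range.2 hi))).resolve_left (hs i)
  refine hu0 0 (eq_zero_of_im_mul_eq_zero him (hureal 0 hq) ?_)
  rw [← husucc]
  exact hureal 1 hqone

/-- `hrec` determines the sign `s n` unless `lam ^ n * v` is real. In that case the growing quantity
`β` decides it at all late times, so the signs become `q`-periodic. -/
theorem false_of_receding {q : ℕ} (hq : 0 < q) (hlamq : lam ^ q = 1) (him : lam.im ≠ 0)
    {v : ℂ} (hv : v ≠ 0) {s : ℕ → ℝ} {z : ℕ → ℂ} (hs : ∀ n, s n = 1 ∨ s n = -1)
    (hz : ∀ n, z (n + 1) = lam * (z n - s n)) (hpos : ∀ n, 0 < s n * (z n).im)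
    (hrec : ∀ n, 0 ≤ s n * (lam ^ n * v).im) : False := by
  have hlam : ‖lam‖ = 1 := Complex.norm_eq_one_of_pow_eq_one hlamq hq.ne'
  have hlam0 : lam ≠ 0 := by
    rintro rfl
    simp at him
  have hs0 : ∀ n, s n ≠ 0 := fun n => by rcases hs n with h | h <;> rw [h] <;> norm_num
  have huper : ∀ n, lam ^ (n + q) * v = lam ^ n * v := fun n => by rw [pow_add, hlamq, mul_one]
  set β : ℕ → ℝ := fun n => (z n * conj (lam ^ n * v)).im with hβ
  have hstep : ∀ n, β (n + 1) = β n + s n * (lam ^ n * v).im := fun n => by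
    simp only [hβ]
    rw [conj_mul_step hlam hz, Complex.sub_im, Complex.im_ofReal_mul, Complex.conj_im]
    ring
  have hmono : Monotone β := monotone_nat_of_le_succ fun n => by
    rw [hstep]
    linarith [hrec n]
  have habs : ∀ n, s n * (lam ^ n * v).im = |(lam ^ n * v).im| := fun n => by
    have h := abs_of_nonneg (hrec n)
    rw [abs_mul, show |s n| = 1 by rcases hs n with h | h <;> simp [h], one_mul] at h
    exact h.symm
  have hgap : 0 < β 2 - β 0 := by
    have h0 := hstep 0
    have h1 := hstep 1
    rw [habs] at h0 h1
    have hpos0 := abs_nonneg (lam ^ 0 * v).im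
    have hpos1 := abs_nonneg (lam ^ 1 * v).im
    norm_num only at h0 h1
    by_contra! hle
    have e0 : (lam ^ 0 * v).im = 0 := abs_eq_zero.1 (by linarith)
    have e1 : (lam ^ 1 * v).im = 0 := abs_eq_zero.1 (by linarith)
    rw [pow_zero, one_mul] at e0
    rw [pow_one] at e1
    exact hv (eq_zero_of_im_mul_eq_zero him e0 e1)
  have htwo : ∀ n, β (n + 2) = β n + |(lam ^ n * v).im| + |(lam ^ (n + 1) * v).im| := fun n => by
    rw [show n + 2 = n + 1 + 1 from rfl, hstep, hstep, habs, habs]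
  -- The increments of `β` recur with period `q`. Blocks of length `2 * q` are long enough to
  -- contain the two steps that give the gap.
  have hgapk : ∀ k : ℕ, β 0 + k * (β 2 - β 0) ≤ β (k * (2 * q)) := by
    intro k
    induction k with
    | zero => simp
    | succ k ih =>
      have hpow : ∀ j, lam ^ (k * (2 * q) + j) * v = lam ^ j * v := fun j => by
        rw [pow_add, show k * (2 * q) = q * (2 * k) by ring, pow_mul, hlamq, one_pow, one_mul]
      have h1 := htwo (k * (2 * q))
      have h2 := htwo 0
      have h3 := hpow 0
      rw [hpow 1] at h1
      rw [add_zero] at h3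
      rw [h3] at h1
      rw [zero_add, zero_add] at h2
      have h4 : β (k * (2 * q) + 2) ≤ β ((k + 1) * (2 * q)) := hmono (by nlinarith)
      push_cast
      linarith
  obtain ⟨N, hN⟩ : ∃ N, 0 < β N := by
    obtain ⟨k, hk⟩ := exists_nat_gt (-β 0 / (β 2 - β 0))
    rw [div_lt_iff₀ hgap] at hk
    exact ⟨_, lt_of_lt_of_le (by linarith) (hgapk k)⟩
  have hreal : ∀ n, N ≤ n → (lam ^ n * v).im = 0 → 0 < s n * (lam ^ n * v).re := by
    intro n hn h0
    have hβn : 0 < β n := hN.trans_le (hmono hn)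
    have hβre : β n = (z n).im * (lam ^ n * v).re := by
      simp only [hβ]
      rw [Complex.mul_im, Complex.conj_im, Complex.conj_re, h0]
      ring
    rw [hβre] at hβn
    have h := mul_pos (hpos n) hβn
    have h2 : 0 < (z n).im ^ 2 := by
      have : (z n).im ≠ 0 := fun h => by simp [h] at hβn
      positivity
    have h3 : 0 < (z n).im ^ 2 * (s n * (lam ^ n * v).re) := by linarith
    exact pos_of_mul_pos_right h3 h2.le
  have hper : ∀ n, N ≤ n → s (n + q) = s n := by
    intro n hn
    -- `x` is the imaginary part of `lam ^ n * v`, or its real part if that vanishes. Its sign fixes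
    -- both `s n` and `s (n + q)`.
    obtain ⟨x, hx0, hx1, hx2⟩ : ∃ x : ℝ, x ≠ 0 ∧ 0 ≤ s n * x ∧ 0 ≤ s (n + q) * x := by
      by_cases h0 : (lam ^ n * v).im = 0
      · have h1 := hreal n hn h0
        have h2 := hreal (n + q) (by omega) (by rw [huper, h0])
        rw [huper] at h2
        exact ⟨_, right_ne_zero_of_mul h1.ne', h1.le, h2.le⟩
      · have h2 := hrec (n + q)
        rw [huper] at h2
        exact ⟨_, h0, hrec n, h2⟩
    rcases hs n with h | h <;> rcases hs (n + q) with h' | h' <;> rw [h] at hx1 ⊢ <;>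
      rw [h'] at hx2 ⊢ <;> exact absurd (by linarith : x = 0) hx0
  refine false_of_periodic_signs hq hlamq him (v := lam ^ N * v) (s := fun n => s (n + N))
    (z := fun n => z (n + N)) (mul_ne_zero (pow_ne_zero _ hlam0) hv) (fun n => hs0 _)
    (fun n => ?_) (fun n => ?_) (fun n => hpos _) (fun n => ?_)
  · rw [← hper (n + N) (by omega)]
    exact congrArg s (by omega)
  · rw [← hz]
    exact congrArg z (by omega)
  · rw [← mul_assoc, ← pow_add]
    exact hrec _

theorem H_eq_sign {z : ℂ} (hz : z.im ≠ 0) : H z = ((SignType.sign z.im : ℝ) : ℂ) := by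
  rcases lt_or_gt_of_ne hz with h | h
  · simp [H, sign_neg h, not_le.2 h]
  · simp [H, sign_pos h, h.le]

theorem isBounded_sameItinerary {q : ℕ} (hq : 0 < q) (hlamq : lam ^ q = 1) (him : lam.im ≠ 0)
    {z : ℂ} (hz : z ∈ regularSet lam) :
    Bornology.IsBounded (sameItinerary lam (itinerary lam z)) := by
  by_contra hb
  have hne : ∀ w ∈ regularSet lam, ∀ n, ((F lam)^[n] w).im ≠ 0 :=
    fun w hw n h => hw (subset_closure ⟨n, h⟩)
  have hfar : ∀ k : ℕ, ∃ w ∈ sameItinerary lam (itinerary lam z), (k : ℝ) + 1 < ‖w - z‖ := by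
    intro k
    by_contra! h
    exact hb ((Metric.isBounded_iff_subset_closedBall z).2
      ⟨k + 1, fun w hw => mem_closedBall_iff_norm.2 (h w hw)⟩)
  choose w hwB hw using hfar
  have hwpos : ∀ k, 0 < ‖w k - z‖ := fun k => lt_trans (by positivity) (hw k)
  have hsphere : ∀ k, (‖w k - z‖⁻¹ : ℝ) • (w k - z) ∈ Metric.sphere (0 : ℂ) 1 := fun k => by
    rw [mem_sphere_zero_iff_norm, norm_smul, norm_inv, norm_norm, inv_mul_cancel₀ (hwpos k).ne']
  -- `v` is a limit of unit directions from `z` to points of `B` that run off to infinity.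
  obtain ⟨v, hv, φ, hφ, hlim⟩ := (isCompact_sphere (0 : ℂ) 1).tendsto_subseq hsphere
  have hinv : Filter.Tendsto (fun k => ‖w (φ k) - z‖⁻¹) Filter.atTop (nhds 0) := by
    refine Filter.Tendsto.inv_tendsto_atTop ?_
    refine Filter.tendsto_atTop_mono (fun k => ?_) tendsto_natCast_atTop_atTop
    have h1 : (k : ℝ) ≤ φ k := by exact_mod_cast hφ.id_le k
    linarith [hw (φ k)]
  set s : ℕ → ℝ := fun n => (itinerary lam z n : ℝ) with hs
  have hsx : ∀ n, ∀ x ∈ sameItinerary lam (itinerary lam z), 0 < s n * ((F lam)^[n] x).im := by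
    intro n x hx
    have h : s n = SignType.sign ((F lam)^[n] x).im := by
      simp only [hs]
      rw [← hx.2]
      rfl
    rw [h, sign_mul_self]
    exact abs_pos.2 (hne x hx.1 n)
  refine false_of_receding hq hlamq him (v := v) (s := s) (z := fun n => (F lam)^[n] z)
    (fun h => ?_) (fun n => ?_) (fun n => ?_) (fun n => hsx n z ⟨hz, rfl⟩) (fun n => ?_)
  · rw [h] at hv
    simp at hv
  · rcases itinerary_eq_one_or_neg_one hz n with h | h <;> simp [hs, h]
  · rw [Function.iterate_succ_apply', F, H_eq_sign (hne z hz n)]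
    rfl
  -- The sign condition at `w (φ k)`, divided by the distance to `z`, becomes in the limit the
  -- recession condition on `v`.
  · have hl : Filter.Tendsto (fun k => ‖w (φ k) - z‖⁻¹ * (s n * ((F lam)^[n] z).im)
        + s n * (lam ^ n * ((‖w (φ k) - z‖⁻¹ : ℝ) • (w (φ k) - z))).im) Filter.atTop
        (nhds (0 * (s n * ((F lam)^[n] z).im) + s n * (lam ^ n * v).im)) := by
      refine (hinv.mul_const _).add (Filter.Tendsto.const_mul _ ?_)
      exact (Complex.continuous_im.tendsto _).comp (hlim.const_mul _)
    rw [zero_mul, zero_add] at hl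
    refine ge_of_tendsto' hl fun k => ?_
    have h1 := hsx n _ (hwB (φ k))
    have h2 : (F lam)^[n] (w (φ k)) = (F lam)^[n] z + lam ^ n * (w (φ k) - z) := by
      rw [← F_iterate_sub (x := w (φ k)) (y := z) fun i _ => by rw [(hwB (φ k)).2]]
      ring
    rw [h2, Complex.add_im] at h1
    rw [mul_smul_comm, Complex.smul_im, smul_eq_mul]
    have h3 := mul_pos (inv_pos.2 (hwpos (φ k))) h1
    linarith

end Bounded

/-! ### Affine self-maps of a bounded convex set, and roots of unity. -/

section Return

variable {lam : ℂ}

/-- An affine map `w ↦ a * w + d` with `a ^ q = 1` that maps a bounded non-empty set to itself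
is periodic with period `q` on it. -/
theorem iterate_eq_self_of_mapsTo_isBounded {B : Set ℂ} (hB : Bornology.IsBounded B) {g : ℂ → ℂ}
    (hg : Set.MapsTo g B B) {a : ℂ} {q : ℕ} (ha : a ^ q = 1)
    (hga : ∀ x ∈ B, ∀ y ∈ B, g x - g y = a * (x - y)) {w : ℂ} (hw : w ∈ B) : g^[q] w = w := by
  have hmem : ∀ n, ∀ x ∈ B, g^[n] x ∈ B := fun n x hx => hg.iterate n hx
  have hpow : ∀ n, ∀ x ∈ B, ∀ y ∈ B, g^[n] x - g^[n] y = a ^ n * (x - y) := by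
    intro n x hx y hy
    induction n with
    | zero => simp
    | succ n ih =>
      rw [Function.iterate_succ_apply', Function.iterate_succ_apply', hga _ (hmem n x hx) _
        (hmem n y hy), ih, pow_succ']
      ring
  set d := g^[q] w - w with hd
  have htrans : ∀ k : ℕ, (g^[q])^[k] w = w + k * d := by
    intro k
    induction k with
    | zero => simp
    | succ k ih =>
      have hk : (g^[q])^[k] w ∈ B := by
        rw [← Function.iterate_mul]
        exact hmem _ w hw
      have h := hpow q _ hk w hw
      rw [ha, one_mul] at h
      rw [Function.iterate_succ_apply']
      push_cast
      linear_combination h + ih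
  obtain ⟨R, hR⟩ := (Metric.isBounded_iff_subset_closedBall w).1 hB
  by_contra hne
  have hdpos : 0 < ‖d‖ := norm_pos_iff.2 (sub_ne_zero.2 hne)
  obtain ⟨k, hk⟩ := exists_nat_gt (R / ‖d‖)
  rw [div_lt_iff₀ hdpos] at hk
  have hkB : (g^[q])^[k] w ∈ B := by
    rw [← Function.iterate_mul]
    exact hmem _ w hw
  have := hR hkB
  rw [htrans, mem_closedBall_iff_norm, add_sub_cancel_left, norm_mul, Complex.norm_natCast] at this
  linarith

/-- A map of a convex set to itself that multiplies differences by `a` and has period `q` fixes the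
centre of mass of an orbit. -/
theorem exists_fixed_of_iterate_eq_self {B : Set ℂ} (hB : Convex ℝ B) {g : ℂ → ℂ}
    (hg : Set.MapsTo g B B) {a : ℂ} (hga : ∀ x ∈ B, ∀ y ∈ B, g x - g y = a * (x - y))
    {q : ℕ} (hq : 0 < q) {w : ℂ} (hw : w ∈ B) (hgw : g^[q] w = w) : ∃ c ∈ B, g c = c := by
  have hmem : ∀ n, g^[n] w ∈ B := fun n => hg.iterate n hw
  have hq0 : (q : ℂ) ≠ 0 := by exact_mod_cast hq.ne'
  set c : ℂ := ∑ i ∈ Finset.range q, (q : ℝ)⁻¹ • g^[i] w with hc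
  have hcB : c ∈ B := by
    refine hB.sum_mem (fun i _ => by positivity) ?_ fun i _ => hmem i
    rw [Finset.sum_const, Finset.card_range, nsmul_eq_mul, mul_inv_cancel₀]
    exact_mod_cast hq.ne'
  refine ⟨c, hcB, ?_⟩
  have hqc : (q : ℂ) * c = ∑ i ∈ Finset.range q, g^[i] w := by
    rw [hc, Finset.mul_sum]
    refine Finset.sum_congr rfl fun i _ => ?_
    rw [Complex.real_smul]
    push_cast
    rw [← mul_assoc, mul_inv_cancel₀ hq0, one_mul]
  have hshift : ∑ i ∈ Finset.range q, g (g^[i] w) = ∑ i ∈ Finset.range q, g^[i] w := by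
    have h1 := Finset.sum_range_succ (fun i => g^[i] w) q
    have h2 := Finset.sum_range_succ' (fun i => g^[i] w) q
    rw [h1, hgw, Function.iterate_zero, id_eq] at h2
    rw [add_right_cancel h2]
    exact Finset.sum_congr rfl fun i _ => (Function.iterate_succ_apply' g i w).symm
  have hdiff : ∑ i ∈ Finset.range q, (g (g^[i] w) - g c)
      = ∑ i ∈ Finset.range q, a * (g^[i] w - c) :=
    Finset.sum_congr rfl fun i _ => hga _ (hmem i) c hcB
  rw [← Finset.mul_sum, Finset.sum_sub_distrib, Finset.sum_sub_distrib, hshift, ← hqc,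
    Finset.sum_const, Finset.sum_const, Finset.card_range, nsmul_eq_mul, nsmul_eq_mul, sub_self,
    mul_zero, ← mul_sub] at hdiff
  exact (sub_eq_zero.1 ((mul_eq_zero.1 hdiff).resolve_left hq0)).symm

theorem isPrimitiveRoot_rootOfUnity {p q : ℕ} (hpq : Nat.Coprime p q) (hq : q ≠ 0) :
    IsPrimitiveRoot (rootOfUnity p q) q := by
  have h := Complex.isPrimitiveRoot_exp_of_coprime p q hq hpq
  rwa [mul_comm] at h

theorem im_ne_zero_of_isPrimitiveRoot {q : ℕ} (hq : 3 ≤ q) (h : IsPrimitiveRoot lam q) :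
    lam.im ≠ 0 := by
  intro h0
  have hn : ‖lam‖ = 1 := Complex.norm_eq_one_of_pow_eq_one h.pow_eq_one (by omega)
  have h2 : lam ^ 2 = 1 := by
    rw [sq]
    nth_rewrite 2 [← Complex.conj_eq_iff_im.2 h0]
    exact norm_mul_conj_eq_one hn
  have := Nat.le_of_dvd two_pos ((h.pow_eq_one_iff_dvd 2).1 h2)
  omega

end Return

end PiecewiseRotation

/-! ### The return map and the main theorem. -/

open PiecewiseRotation in
theorem mainTheorem4 (p q : ℕ) (hpq : Nat.Coprime p q) (hq : 3 ≤ q) (lam : ℂ)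
    (hlam : lam = PiecewiseRotation.rootOfUnity p q) (z : ℂ)
    (hz : z ∈ PiecewiseRotation.regularSet lam) (B : Set ℂ)
    (hB : B = PiecewiseRotation.sameItinerary lam (PiecewiseRotation.itinerary lam z)) :
    (PiecewiseRotation.itinerary lam z ∈ Function.periodicPts PiecewiseRotation.shift ↔
      z ∈ Function.periodicPts (PiecewiseRotation.F lam)) ∧
    Bornology.IsBounded B ∧
    Convex ℝ B ∧
    ∀ l : ℕ, 0 < l →
      Function.minimalPeriod PiecewiseRotation.shift (PiecewiseRotation.itinerary lam z) = l →
      Set.BijOn (PiecewiseRotation.F lam)^[l] B B ∧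
      (∀ w ∈ B, ∀ n : ℕ, 0 < n → n < l → (PiecewiseRotation.F lam)^[n] w ∉ B) ∧
      (¬ q ∣ l → lam ^ l ≠ 1 ∧
        ∃ c ∈ B, ∀ w ∈ B, (PiecewiseRotation.F lam)^[l] w = c + lam ^ l * (w - c)) ∧
      (q ∣ l → ∀ w ∈ B, (PiecewiseRotation.F lam)^[l] w = w) := by
  have hprim : IsPrimitiveRoot lam q := by
    rw [hlam]
    exact isPrimitiveRoot_rootOfUnity hpq (by omega)
  have hlamq : lam ^ q = 1 := hprim.pow_eq_one
  have hq0 : 0 < q := by omega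
  have hnorm : ‖lam‖ = 1 := Complex.norm_eq_one_of_pow_eq_one hlamq hq0.ne'
  have him : lam.im ≠ 0 := im_ne_zero_of_isPrimitiveRoot hq hprim
  have hJ : ∀ i, itinerary lam z i ≠ 0 := fun i => by
    rcases itinerary_eq_one_or_neg_one hz i with h | h <;> rw [h] <;> decide
  have hzB : z ∈ B := hB ▸ ⟨hz, rfl⟩
  have hbdd : Bornology.IsBounded B := hB ▸ isBounded_sameItinerary hq0 hlamq him hz
  have hconv : Convex ℝ B := by
    rw [hB, sameItinerary_eq_interior hJ]
    exact (convex_setOf_itinerary _).interior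
  have hmaps : ∀ l, shift^[l] (itinerary lam z) = itinerary lam z →
      Set.MapsTo (F lam)^[l] B B := by
    intro l hl w hw
    rw [hB] at hw ⊢
    exact F_iterate_mem_sameItinerary hnorm hJ hl hw
  have haff : ∀ l, ∀ x ∈ B, ∀ y ∈ B, (F lam)^[l] x - (F lam)^[l] y = lam ^ l * (x - y) := by
    intro l x hx y hy
    rw [hB] at hx hy
    exact F_iterate_sub fun i _ => by rw [hx.2, hy.2]
  have hiter : ∀ l, shift^[l] (itinerary lam z) = itinerary lam z →
      ∀ w ∈ B, ((F lam)^[l])^[q] w = w := by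
    intro l hl w hw
    refine iterate_eq_self_of_mapsTo_isBounded hbdd (hmaps l hl) ?_ (haff l) hw
    rw [← pow_mul, mul_comm, pow_mul, hlamq, one_pow]
  refine ⟨⟨?_, ?_⟩, hbdd, hconv, ?_⟩
  · rintro ⟨l, hl, hper⟩
    refine ⟨l * q, Nat.mul_pos hl hq0, ?_⟩
    have h := hiter l hper z hzB
    rwa [← Function.iterate_mul] at h
  · rintro ⟨n, hn, hper⟩
    exact ⟨n, hn, hper.map semiconj_itinerary⟩
  · intro l hl hmin
    have hper : shift^[l] (itinerary lam z) = itinerary lam z := by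
      rw [← hmin]
      exact Function.iterate_minimalPeriod
    refine ⟨⟨hmaps l hper, ?_, ?_⟩, ?_, ?_, ?_⟩
    · intro x hx y hy hxy
      have hx' := hiter l hper x hx
      have hy' := hiter l hper y hy
      obtain ⟨m, rfl⟩ : ∃ m, q = m + 1 := ⟨q - 1, by omega⟩
      rw [Function.iterate_succ_apply, hxy] at hx'
      rw [Function.iterate_succ_apply] at hy'
      exact hx'.symm.trans hy'
    · intro w hw
      have hw' := hiter l hper w hw
      obtain ⟨m, rfl⟩ : ∃ m, q = m + 1 := ⟨q - 1, by omega⟩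
      rw [Function.iterate_succ_apply'] at hw'
      exact ⟨_, (hmaps l hper).iterate m hw, hw'⟩
    · intro w hw n hn hnl hmem
      rw [hB] at hw hmem
      have h : Function.IsPeriodicPt shift n (itinerary lam z) := by
        have := hmem.2
        rwa [itinerary_F_iterate, hw.2] at this
      have := h.minimalPeriod_le hn
      omega
    · intro hql
      refine ⟨fun h => hql ((hprim.pow_eq_one_iff_dvd l).1 h), ?_⟩
      obtain ⟨c, hc, hfix⟩ := exists_fixed_of_iterate_eq_self hconv (hmaps l hper) (haff l) hq0 hzB
        (hiter l hper z hzB)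
      refine ⟨c, hc, fun w hw => ?_⟩
      rw [← haff l w hw c hc, hfix]
      ring
    · intro hql w hw
      -- Here `lam ^ l = 1`, so `F^l` is itself a translation of the bounded set `B` and exponent
      -- `1` suffices.
      have h := iterate_eq_self_of_mapsTo_isBounded hbdd (hmaps l hper) (q := 1)
        (by rw [pow_one]; exact (hprim.pow_eq_one_iff_dvd l).2 hql) (haff l) hw
      rwa [Function.iterate_one] at h
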